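/- Let $d,n\ge 1$ be integers, let $\mathbf{F}\in\{\mathbf{R},\mathbf{C}\}$, and let $\mathcal{K}$ be the collection of non-empty closed convex sets $K\subseteq\mathbf{F}^n$ that are symmetric, i.e., $\lambda u\in K$ for all $u\in K$ and all $\lambda\in\mathbf{F}$ with $|\lambda|=1$. A map $F:\mathbf{R}^d\to\mathcal{K}$ is measurable if $\{x: F(x)\cap E\neq\emptyset\}$ is Lebesgue measurable for every Borel set $E\subseteq\mathbf{F}^n$. For such $F$, let $S^0(F)$ be the set of measurable $f:\mathbf{R}^d\to\mathbf{F}^n$ with $f(x)\in F(x)$ for a.e. $x$. For a measurable set $E\subseteq\mathbf{R}^d$, let $F\mathbf{1}_E$ be the map equal to $F(x)$ for $x\in E$ and to $\{0\}$ for $x\notin E$. Cubes are half-open with sides parallel to the coordinate axes. We call $F$ locally integrably bounded, $F\in L^1_{\mathrm{loc}}(\mathbf{R}^d;\mathcal{K})$, if $F$ is measurable and $S^0(F\mathbf{1}_Q)$ is a bounded subset of $L^1(\mathbf{R}^d;\mathbf{F}^n)$ for every cube $Q$; then \[ \langle F\rangle_Q:=\Big\{\frac{1}{|Q|}\int_{\mathbf{R}^d}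 f\,\mathrm{d}x : f\in S^0(F\mathbf{1}_Q)\Big\}. \] For a collection $\mathcal{P}$ of cubes, $M^{\mathcal{K}}_{\mathcal{P}}F(x)$ is the smallest set in $\mathcal{K}$ that contains $\bigcup_{Q\in\mathcal{P}}\langle F\rangle_Q\mathbf{1}_Q(x)$, where $\langle F\rangle_Q\mathbf{1}_Q(x)$ is $\langle F\rangle_Q$ if $x\in Q$ and $\{0\}$ otherwise. A dyadic grid is a collection $\mathcal{D}$ of cubes for which there is an $\ell_0>0$ such that every cube in $\mathcal{D}$ has side length $2^k\ell_0$ for some $k\in\mathbf{Z}$, for each $k\in\mathbf{Z}$ the cubes of side length $2^k\ell_0$ in $\mathcal{D}$ partition $\mathbf{R}^d$, and any two cubes in $\mathcal{D}$ are nested or disjoint. A collection $\mathcal{S}$ of cubes is sparse if for all $Q\in\mathcal{S}$ \[ \Big|\bigcup_{Q'\in\mathcal{S},\ Q'\subsetneq Q}Q'\Big|\le\tfrac12|Q|. \] Theorem. Let $\mathcal{D}$ be a dyadic grid and let $\mathcal{F}\subseteq\mathcal{D}$ be finite. For every $F\in L^1_{\mathrm{loc}}(\mathbf{R}^d;\mathcal{K})$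 there is a sparse collection $\mathcal{S}\subseteq\mathcal{F}$ such that \[ M^{\mathcal{K}}_{\mathcal{F}}F(x)\subseteq 2n^{5/2}\,M^{\mathcal{K}}_{\mathcal{S}}F(x) \] for a.e. $x\in\mathbf{R}^d$. -/

import Mathlib

open MeasureTheory Set
open scoped ENNReal NNReal Pointwise

namespace ConvexBody

/-- The collection `𝒦` of non-empty, closed, convex and symmetric subsets of `𝕜ⁿ`, where `𝕜` is
`ℝ` or `ℂ`. Symmetric means invariant under multiplication by scalars of modulus one. -/
def convexBodies (𝕜 : Type*) [RCLike 𝕜] (n : ℕ) : Set (Set (EuclideanSpace 𝕜 (Fin n))) :=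
  {K | K.Nonempty ∧ IsClosed K ∧ Convex ℝ K ∧ ∀ u ∈ K, ∀ c : 𝕜, ‖c‖ = 1 → c • u ∈ K}

/-- `𝒦(B)`, the smallest set in `𝒦` that contains `B`. -/
def hull {𝕜 : Type*} [RCLike 𝕜] {n : ℕ} (B : Set (EuclideanSpace 𝕜 (Fin n))) :
    Set (EuclideanSpace 𝕜 (Fin n)) :=
  ⋂₀ {K | K ∈ convexBodies 𝕜 n ∧ B ⊆ K}

section SetValued

variable {Ω : Type*} [MeasurableSpace Ω] {𝕜 : Type*} [RCLike 𝕜] {n : ℕ}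

/-- `F ∈ L⁰(Ω; 𝒦)`: the map `F` takes values in `𝒦`, and `{x | F x ∩ E ≠ ∅}` is measurable
with respect to the completion of `μ` for every Borel set `E ⊆ 𝕜ⁿ`. -/
def MemL0 (μ : Measure Ω) (F : Ω → Set (EuclideanSpace 𝕜 (Fin n))) : Prop :=
  (∀ x, F x ∈ convexBodies 𝕜 n) ∧
    ∀ E : Set (EuclideanSpace 𝕜 (Fin n)), MeasurableSet[borel _] E →
      NullMeasurableSet {x | (F x ∩ E).Nonempty} μ

/-- `S⁰(Ω; F)`, the measurable selections of `F`. -/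
def selections (μ : Measure Ω) (F : Ω → Set (EuclideanSpace 𝕜 (Fin n))) :
    Set (Ω → EuclideanSpace 𝕜 (Fin n)) :=
  {f | AEStronglyMeasurable f μ ∧ ∀ᵐ x ∂μ, f x ∈ F x}

/-- `F ∈ L¹(Ω; 𝒦)`: `F ∈ L⁰(Ω; 𝒦)` and the measurable selections of `F` form a bounded subset
of `L¹(Ω; 𝕜ⁿ)`. -/
def MemL1 (μ : Measure Ω) (F : Ω → Set (EuclideanSpace 𝕜 (Fin n))) : Prop :=
  MemL0 μ F ∧ ∃ C : ℝ≥0, ∀ f ∈ selections μ F, eLpNorm f 1 μ ≤ C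

/-- `F 𝟙_E`, equal to `F x` for `x ∈ E` and to `{0}` for `x ∉ E`. -/
noncomputable def restrictTo (E : Set Ω) (F : Ω → Set (EuclideanSpace 𝕜 (Fin n))) :
    Ω → Set (EuclideanSpace 𝕜 (Fin n)) :=
  open Classical in fun x => if x ∈ E then F x else {0}

/-- The Aumann integral of `F`: the set of integrals of the integrable measurable selections of
`F`. When `F ∈ L¹(Ω; 𝒦)`, every measurable selection of `F` is integrable. -/
noncomputable def aumannIntegral (μ : Measure Ω) (F : Ω → Set (EuclideanSpace 𝕜 (Fin n))) :
    Set (EuclideanSpace 𝕜 (Fin n)) :=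
  {v | ∃ f ∈ selections μ F, Integrable f μ ∧ ∫ x, f x ∂μ = v}

/-- `⟨F⟩_E`, the average of `F` over `E`. -/
noncomputable def average (μ : Measure Ω) (E : Set Ω)
    (F : Ω → Set (EuclideanSpace 𝕜 (Fin n))) : Set (EuclideanSpace 𝕜 (Fin n)) :=
  (μ.real E)⁻¹ • aumannIntegral μ (restrictTo E F)

/-- `T_E F = ⟨F⟩_E 𝟙_E`. -/
noncomputable def averagingOperator (μ : Measure Ω) (E : Set Ω)
    (F : Ω → Set (EuclideanSpace 𝕜 (Fin n))) : Ω → Set (EuclideanSpace 𝕜 (Fin n)) :=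
  restrictTo E (fun _ => average μ E F)

/-- The convex-set valued maximal operator over a collection `P`: the supremum in `𝒦`, ordered by
inclusion, of the sets `⟨F⟩_Q 𝟙_Q(x)` with `Q ∈ P`. -/
noncomputable def maximalOperator (μ : Measure Ω) (P : Set (Set Ω))
    (F : Ω → Set (EuclideanSpace 𝕜 (Fin n))) : Ω → Set (EuclideanSpace 𝕜 (Fin n)) :=
  fun x => hull (⋃ Q ∈ P, averagingOperator μ Q F x)

end SetValued

section Cubes

variable {d : ℕ}

/-- The half-open cube with corner `a` and side length `l`, with sides parallel to the axes. -/
def cube (a : EuclideanSpace ℝ (Fin d)) (l : ℝ) : Set (EuclideanSpace ℝ (Fin d)) :=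
  {x | ∀ i, a i ≤ x i ∧ x i < a i + l}

/-- `D` is a dyadic grid: for some base side length `l₀ > 0`, every member of `D` is a cube of side
length `2ᵏ l₀` for some integer `k`; for each `k` the members of side length `2ᵏ l₀` partition
`ℝᵈ`; and any two members are nested or disjoint. -/
def IsDyadicGrid (D : Set (Set (EuclideanSpace ℝ (Fin d)))) : Prop :=
  ∃ l₀ : ℝ, 0 < l₀ ∧
    (∀ Q ∈ D, ∃ (k : ℤ) (a : EuclideanSpace ℝ (Fin d)), Q = cube a ((2 : ℝ) ^ k * l₀)) ∧
    (∀ (k : ℤ) (x : EuclideanSpace ℝ (Fin d)),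
      ∃! Q, Q ∈ D ∧ (∃ a, Q = cube a ((2 : ℝ) ^ k * l₀)) ∧ x ∈ Q) ∧
    ∀ Q ∈ D, ∀ R ∈ D, Q ⊆ R ∨ R ⊆ Q ∨ Disjoint Q R

/-- `S` is sparse: for each `Q ∈ S`, the members of `S` that are strictly contained in `Q` cover
at most half of `Q`. -/
def IsSparse (S : Set (Set (EuclideanSpace ℝ (Fin d)))) : Prop :=
  ∀ Q ∈ S, volume (⋃₀ {Q' | Q' ∈ S ∧ Q' ⊂ Q}) ≤ volume Q / 2

/-- `F ∈ L¹_loc(ℝᵈ; 𝒦)`, that is, `F` is locally integrably bounded: `F ∈ L⁰(ℝᵈ; 𝒦)` and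
`F 𝟙_Q ∈ L¹(ℝᵈ; 𝒦)` for all cubes `Q`. -/
def MemL1Loc {𝕜 : Type*} [RCLike 𝕜] {n : ℕ}
    (F : EuclideanSpace ℝ (Fin d) → Set (EuclideanSpace 𝕜 (Fin n))) : Prop :=
  MemL0 volume F ∧
    ∀ (a : EuclideanSpace ℝ (Fin d)) (l : ℝ), 0 < l → MemL1 volume (restrictTo (cube a l) F)

end Cubes

end ConvexBody

/-! The proof is a stopping-time argument. With `C = 2 * n ^ (5 / 2)`, call a cube `R ⊆ Q` bad for
`Q` if `⟨F⟩_R` is not contained in `C` times the hull of `K = ⟨F⟩_Q`. `exists_stopping_family`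
selects `S` so that every cube of the family is good for some member of `S` above it, and the
members of `S` strictly below `Q` lie in cubes bad for `Q`. The former gives the domination, the
latter reduces sparseness to a weak-type bound.

That bound is `mul_sum_measureReal_le`. In an Auerbach basis the coordinates are at most one on `K`,
while a vector whose coordinates have absolute sum at most one lies in the hull of `K`. A bad `R`
therefore carries a selection whose integral has coordinate sum at least `C|R|`. For disjoint `R`,
these selections, multiplied by suitable phases, paste into one selection of `F 𝟙_Q`, so each
coordinate sums to at most `|Q|` over all `R`. Hence `C ∑|R| ≤ n|Q|`, and `C ≥ 2n` suffices. -/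

/-! ### Auerbach bases. -/

/-- **Auerbach's lemma**, for a bounded set in place of a unit ball: the span of `K` has a basis
in `closure K` whose dual basis is bounded by one on `K`. -/
theorem exists_auerbach_basis (𝕜 : Type*) [RCLike 𝕜] {E : Type*} [NormedAddCommGroup E]
    [NormedSpace 𝕜 E] [FiniteDimensional 𝕜 E] {K : Set E} (hK : Bornology.IsBounded K) :
    ∃ (v : Fin (Module.finrank 𝕜 (Submodule.span 𝕜 K)) → E)
      (c : Fin (Module.finrank 𝕜 (Submodule.span 𝕜 K)) → E →L[𝕜] 𝕜),
      (∀ i, v i ∈ closure K) ∧ (∀ i, ∀ w ∈ K, ‖c i w‖ ≤ 1) ∧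
        ∀ w ∈ Submodule.span 𝕜 K, ∑ i, c i w • v i = w := by
  classical
  obtain ⟨v₀, hv₀K, hv₀span, hv₀ind⟩ := Submodule.exists_fun_fin_finrank_span_eq 𝕜 K
  let W := Submodule.span 𝕜 K
  let u₀ : Fin (Module.finrank 𝕜 W) → W := fun i => ⟨v₀ i, Submodule.subset_span (hv₀K i)⟩
  have hu₀ : LinearIndependent 𝕜 u₀ := LinearIndependent.of_comp W.subtype hv₀ind
  have hu₀span : ⊤ ≤ Submodule.span 𝕜 (range u₀) :=
    (hu₀.span_eq_top_of_card_eq_finrank' (by simp)).ge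
  let b := Module.Basis.mk hu₀ hu₀span
  let K' : Set W := Subtype.val ⁻¹' closure K
  have hK'c : IsCompact K' := by
    have : ProperSpace E := FiniteDimensional.proper_rclike 𝕜 E
    exact (Submodule.closed_of_finiteDimensional W).isClosedEmbedding_subtypeVal.isCompact_preimage
      hK.isCompact_closure
  have hu₀K' : u₀ ∈ pi univ fun _ => K' := fun i _ => subset_closure (hv₀K i)
  have hcont : Continuous fun w : Fin (Module.finrank 𝕜 W) → W => ‖b.det w‖ := by
    refine continuous_norm.comp ?_
    change Continuous fun w : Fin (Module.finrank 𝕜 W) → W => (b.toMatrix w).det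
    refine Continuous.matrix_det (continuous_matrix fun i j => ?_)
    exact (b.coord i).continuous_of_finiteDimensional.comp (continuous_apply j)
  -- The basis maximises the absolute determinant over tuples in the closure; `u₀`, of determinant
  -- one, shows that the maximum is nonzero.
  obtain ⟨u, huK, hmax⟩ := (isCompact_univ_pi fun _ => hK'c).exists_isMaxOn ⟨u₀, hu₀K'⟩
    hcont.continuousOn
  have hdet : b.det u ≠ 0 := by
    have h1 : ‖b.det u₀‖ ≤ ‖b.det u‖ := hmax hu₀K'
    have h2 : b.det u₀ = 1 := by
      have : u₀ = b := by simp [b]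
      rw [this, b.det_self]
    rw [h2, norm_one] at h1
    intro h
    rw [h, norm_zero] at h1
    linarith
  obtain ⟨huind, huspan⟩ := b.is_basis_iff_det.2 hdet.isUnit
  let e := Module.Basis.mk huind huspan.ge
  have he : ∀ i, e i = u i := fun i => by simp [e]
  -- Cramer's rule: with maximality of `u`, it bounds each coordinate by one.
  have hcoord : ∀ (i) (w : W), b.det (Function.update u i w) = e.repr w i * b.det u := by
    intro i w
    conv_lhs => rw [← e.sum_repr w]
    rw [AlternatingMap.map_update_sum, Finset.sum_eq_single i]
    · rw [AlternatingMap.map_update_smul, he, Function.update_eq_self, smul_eq_mul]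
    · intro j _ hj
      rw [AlternatingMap.map_update_smul, he, AlternatingMap.map_update_self _ _ hj.symm, smul_zero]
    · simp
  have hbound : ∀ i, ∀ w ∈ K', ‖e.repr w i‖ ≤ 1 := by
    intro i w hw
    have hmem : Function.update u i w ∈ pi univ fun _ => K' := by
      intro j _
      by_cases hj : j = i
      · subst hj; simpa using hw
      · simpa [hj] using huK j trivial
    have h1 : ‖b.det (Function.update u i w)‖ ≤ ‖b.det u‖ := hmax hmem
    rw [hcoord, norm_mul] at h1
    exact le_of_mul_le_mul_right (by simpa using h1) (norm_pos_iff.2 hdet)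
  choose c hc using fun i => LinearMap.exists_extend (e.coord i)
  have hc' : ∀ i (w : W), c i w = e.repr w i := fun i w => LinearMap.congr_fun (hc i) w
  refine ⟨fun i => u i, fun i => LinearMap.toContinuousLinearMap (c i), fun i => huK i trivial,
    fun i w hw => ?_, fun w hw => ?_⟩
  · have := hc' i ⟨w, Submodule.subset_span hw⟩
    simp only [LinearMap.coe_toContinuousLinearMap']
    rw [this]
    exact hbound i _ (subset_closure hw)
  · have h := congrArg (Subtype.val) (e.sum_repr ⟨w, hw⟩)
    simp only [he, Submodule.coe_sum, Submodule.coe_smul] at h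
    simpa [← hc'] using h

/-! ### Absolutely convex sets and hulls. -/

namespace ConvexBody

section Bodies

variable {𝕜 : Type*} [RCLike 𝕜] {n : ℕ} {K B : Set (EuclideanSpace 𝕜 (Fin n))}

theorem zero_mem_of_mem_convexBodies (hK : K ∈ convexBodies 𝕜 n) : 0 ∈ K := by
  obtain ⟨⟨u, hu⟩, -, hconv, hsymm⟩ := hK
  have h : -u ∈ K := by simpa using hsymm u hu (-1) (by simp)
  simpa using hconv.midpoint_mem hu h

theorem subset_hull (B : Set (EuclideanSpace 𝕜 (Fin n))) : B ⊆ hull B :=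
  subset_sInter fun _ hK => hK.2

theorem hull_subset (hK : K ∈ convexBodies 𝕜 n) (h : B ⊆ K) : hull B ⊆ K :=
  sInter_subset_of_mem ⟨hK, h⟩

theorem hull_mem_convexBodies (B : Set (EuclideanSpace 𝕜 (Fin n))) :
    hull B ∈ convexBodies 𝕜 n := by
  refine ⟨⟨0, ?_⟩, isClosed_sInter fun K hK => hK.1.2.1, convex_sInter fun K hK => hK.1.2.2.1, ?_⟩
  · exact mem_sInter.2 fun K hK => zero_mem_of_mem_convexBodies hK.1
  · exact fun u hu c hc K hK => hK.1.2.2.2 u (hu K hK) c hc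

theorem smul_mem_convexBodies (hK : K ∈ convexBodies 𝕜 n) {r : ℝ} (hr : r ≠ 0) :
    r • K ∈ convexBodies 𝕜 n := by
  refine ⟨hK.1.smul_set, hK.2.1.smul_of_ne_zero hr, hK.2.2.1.smul r, ?_⟩
  rintro _ ⟨u, hu, rfl⟩ c hc
  exact ⟨c • u, hK.2.2.2 u hu c hc, smul_comm r c u⟩

/-- Sets in `𝒦` are absolutely convex. -/
theorem sum_smul_mem_of_mem_convexBodies (hK : K ∈ convexBodies 𝕜 n) {ι : Type*} [Fintype ι]
    {v : ι → EuclideanSpace 𝕜 (Fin n)} (hv : ∀ i, v i ∈ K) {c : ι → 𝕜} (hc : ∑ i, ‖c i‖ ≤ 1) :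
    ∑ i, c i • v i ∈ K := by
  -- Symmetry absorbs the phases, leaving a convex combination scaled towards zero.
  choose s hs hcs using fun i => RCLike.exists_norm_mul_eq_self (c i)
  have hterm : ∀ i, c i • v i = ‖c i‖ • (s i • v i) := fun i => by
    conv_lhs => rw [← hcs i]
    rw [RCLike.real_smul_eq_coe_smul (K := 𝕜), smul_smul, mul_comm]
  have hmem : ∀ i, s i • v i ∈ K := fun i => hK.2.2.2 _ (hv i) _ (hs i)
  rcases (Finset.sum_nonneg fun i _ => norm_nonneg (c i) : 0 ≤ ∑ i, ‖c i‖).eq_or_lt with h0 | hpos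
  · have hz : ∀ i, c i = 0 := fun i => by
      simpa using (Finset.sum_eq_zero_iff_of_nonneg fun i _ => norm_nonneg (c i)).1 h0.symm i
    simpa [hz] using zero_mem_of_mem_convexBodies hK
  · have h := hK.2.2.1.centerMass_mem (t := Finset.univ) (w := fun i => ‖c i‖)
      (z := fun i => s i • v i) (fun i _ => norm_nonneg _) hpos fun i _ => hmem i
    have h2 := hK.2.2.1.smul_mem_of_zero_mem (zero_mem_of_mem_convexBodies hK) h ⟨hpos.le, hc⟩
    rw [Finset.centerMass, smul_smul, mul_inv_cancel₀ hpos.ne', one_smul] at h2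
    simpa only [hterm] using h2

end Bodies

end ConvexBody

/-! ### Selection of the stopping family. -/

/-- Stopping argument for a finite family `P` of sets: if for each `Q ∈ P` the bad sets below `Q`
satisfy a property `p` that passes to smaller sets, then some `S ⊆ P` has the property `p` for
the union of all sets strictly below each member, and every member of `P` is good for a member of
`S` above it. -/
theorem exists_stopping_family {α : Type*} (good : Set α → Set α → Prop)
    (hgood : ∀ Q, good Q Q) (small : Set α → Set α → Prop)
    (hsmall : ∀ Q A B, A ⊆ B → small Q B → small Q A) {P : Set (Set α)} (hP : P.Finite)
    (hbad : ∀ Q ∈ P, small Q (⋃₀ {Q' | Q' ∈ P ∧ Q' ⊆ Q ∧ ¬ good Q' Q})) :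
    ∃ S ⊆ P, (∀ Q ∈ S, small Q (⋃₀ {Q' | Q' ∈ S ∧ Q' ⊂ Q})) ∧
      ∀ Q ∈ P, ∃ R ∈ S, Q ⊆ R ∧ good Q R := by
  induction h : P.ncard using Nat.strong_induction_on generalizing P with
  | _ N ih =>
    subst h
    rcases P.eq_empty_or_nonempty with rfl | hne
    · exact ⟨∅, subset_rfl, by simp, by simp⟩
    obtain ⟨Q₀, hQ₀, hmax⟩ := hP.exists_maximal hne
    -- Below `Q₀`, only sets inside a set bad for `Q₀` survive; each discarded set is itself good
    -- for `Q₀`.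
    let P' := {Q | Q ∈ P ∧ (Q ⊆ Q₀ → ∃ Q' ∈ P, Q' ⊆ Q₀ ∧ ¬ good Q' Q₀ ∧ Q ⊆ Q')}
    have hsub : P' ⊆ P := fun Q hQ => hQ.1
    have hQ₀' : Q₀ ∉ P' := by
      rintro ⟨-, h⟩
      obtain ⟨Q', -, h1, h2, h3⟩ := h subset_rfl
      exact h2 (h1.antisymm h3 ▸ hgood Q₀)
    have hbad' : ∀ Q ∈ P', small Q (⋃₀ {Q' | Q' ∈ P' ∧ Q' ⊆ Q ∧ ¬ good Q' Q}) := by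
      refine fun Q hQ => hsmall _ _ _ (sUnion_subset_sUnion ?_) (hbad Q (hsub hQ))
      exact fun R hR => ⟨hsub hR.1, hR.2⟩
    obtain ⟨S, hSP, hS, hcov⟩ := ih P'.ncard
      (ncard_lt_ncard ⟨hsub, fun h => hQ₀' (h hQ₀)⟩ hP) (hP.subset hsub) hbad' rfl
    refine ⟨insert Q₀ S, insert_subset hQ₀ (hSP.trans hsub), ?_, fun Q hQ => ?_⟩
    · rintro Q (rfl | hQ)
      · refine hsmall _ _ _ ?_ (hbad Q hQ₀)
        refine sUnion_subset ?_
        rintro R ⟨rfl | hR, hRQ⟩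
        · exact (hRQ.2 subset_rfl).elim
        · obtain ⟨Q', h1, h2, h3, h4⟩ := (hSP hR).2 hRQ.1
          exact h4.trans (subset_sUnion_of_mem ⟨h1, h2, h3⟩)
      · refine hsmall _ _ _ (sUnion_subset_sUnion ?_) (hS Q hQ)
        rintro R ⟨rfl | hR, hRQ⟩
        · exact (hRQ.2 (hmax (hsub (hSP hQ)) hRQ.1)).elim
        · exact ⟨hR, hRQ⟩
    · by_cases hQ' : Q ∈ P'
      · obtain ⟨R, hR, h⟩ := hcov Q hQ'
        exact ⟨R, mem_insert_of_mem _ hR, h⟩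
      · have h : ¬ (Q ⊆ Q₀ → ∃ Q' ∈ P, Q' ⊆ Q₀ ∧ ¬ good Q' Q₀ ∧ Q ⊆ Q') := fun h => hQ' ⟨hQ, h⟩
        push Not at h
        refine ⟨Q₀, mem_insert _ _, h.1, ?_⟩
        by_contra hg
        exact h.2 Q hQ h.1 hg subset_rfl


/-! ### Weak-type estimate for averages. -/

namespace ConvexBody

section Averages

variable {Ω : Type*} [MeasurableSpace Ω] {μ : Measure Ω} {𝕜 : Type*} [RCLike 𝕜] {n : ℕ}
  {F : Ω → Set (EuclideanSpace 𝕜 (Fin n))} {Q : Set Ω}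

/-- Supplies the boundedness that Auerbach's lemma requires. -/
theorem isBounded_average (h : MemL1 μ (restrictTo Q F)) :
    Bornology.IsBounded (average μ Q F) := by
  obtain ⟨-, C, hC⟩ := h
  refine Bornology.IsBounded.smul₀ ?_ _
  refine (Metric.isBounded_closedBall (x := 0) (r := (C : ℝ))).subset ?_
  rintro _ ⟨f, hf, -, rfl⟩
  rw [mem_closedBall_zero_iff]
  have h1 : ‖∫ x, f x ∂μ‖ₑ ≤ C := by
    refine (enorm_integral_le_lintegral_enorm f).trans ?_
    rw [← eLpNorm_one_eq_lintegral_enorm]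
    exact hC f hf
  exact_mod_cast (enorm_le_coe.1 h1 : ‖∫ x, f x ∂μ‖₊ ≤ C)

/-- Multiplying selections of `F 𝟙_R` by unimodular constants and adding them up over disjoint
subsets `R` of `Q` gives a selection of `F 𝟙_Q`. -/
theorem sum_smul_mem_selections (hF : ∀ x, F x ∈ convexBodies 𝕜 n) {A : Finset (Set Ω)}
    (hAQ : ∀ R ∈ A, R ⊆ Q) (hA : (A : Set (Set Ω)).PairwiseDisjoint id)
    {f : Set Ω → Ω → EuclideanSpace 𝕜 (Fin n)}
    (hf : ∀ R ∈ A, f R ∈ selections μ (restrictTo R F)) {s : Set Ω → 𝕜} (hs : ∀ R, ‖s R‖ = 1) :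
    (fun x => ∑ R ∈ A, s R • f R x) ∈ selections μ (restrictTo Q F) := by
  refine ⟨Finset.aestronglyMeasurable_fun_sum _ fun R hR => (hf R hR).1.const_smul (s R), ?_⟩
  filter_upwards [(Finset.eventually_all A).2 fun R hR => (hf R hR).2] with x hx
  by_cases h : ∃ R ∈ A, x ∈ R
  · obtain ⟨R, hR, hxR⟩ := h
    rw [Finset.sum_eq_single R]
    · have := hx R hR
      simp only [restrictTo, hxR, hAQ R hR hxR, if_true] at this ⊢
      exact (hF x).2.2.2 _ this _ (hs R)
    · intro R' hR' hne
      have hxR' : x ∉ R' := fun h => disjoint_left.1 (hA hR' hR hne) h hxR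
      have := hx R' hR'
      simp only [restrictTo, hxR', if_false, mem_singleton_iff] at this
      rw [this, smul_zero]
    · exact fun h => (h hR).elim
  · rw [Finset.sum_eq_zero]
    · unfold restrictTo
      split_ifs
      · exact zero_mem_of_mem_convexBodies (hF x)
      · rfl
    · intro R hR
      have := hx R hR
      have hxR : x ∉ R := fun hxR => h ⟨R, hR, hxR⟩
      simp only [restrictTo, hxR, if_false, mem_singleton_iff] at this
      rw [this, smul_zero]

/-- The weak-type estimate: disjoint subsets `R` of `Q` with `⟨F⟩_R ⊈ C ⟨F⟩_Q` have total measure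
at most `n / C` times that of `Q`. -/
theorem mul_sum_measureReal_le (hF : ∀ x, F x ∈ convexBodies 𝕜 n)
    (hFQ : MemL1 μ (restrictTo Q F)) (hQ : 0 < μ.real Q) {C : ℝ} (hC : 0 < C)
    {A : Finset (Set Ω)} (hAQ : ∀ R ∈ A, R ⊆ Q) (hA : (A : Set (Set Ω)).PairwiseDisjoint id)
    (hbad : ∀ R ∈ A, ¬ average μ R F ⊆ C • hull (average μ Q F)) :
    C * ∑ R ∈ A, μ.real R ≤ n * μ.real Q := by
  classical
  set K := average μ Q F
  have hu : ∀ R, ∃ f, R ∈ A → f ∈ selections μ (restrictTo R F) ∧ Integrable f μ ∧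
      (μ.real R)⁻¹ • ∫ x, f x ∂μ ∉ C • hull K := by
    intro R
    by_cases hR : R ∈ A
    · obtain ⟨_, ⟨_, ⟨f, hf, hfi, rfl⟩, rfl⟩, h⟩ := not_subset.1 (hbad R hR)
      exact ⟨f, fun _ => ⟨hf, hfi, h⟩⟩
    · exact ⟨0, fun h => (hR h).elim⟩
  choose f hf using hu
  obtain ⟨v, c, hv, hcK, hspan⟩ := exists_auerbach_basis 𝕜 (isBounded_average hFQ)
  have hvhull : ∀ i, v i ∈ hull K := fun i =>
    closure_minimal (subset_hull K) (hull_mem_convexBodies K).2.1 (hv i)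
  -- Used with `B = A` for the coordinate sums and with singletons to place each integral in the
  -- span of `K`.
  have hmemK : ∀ (B : Finset (Set Ω)), B ⊆ A → ∀ s : Set Ω → 𝕜, (∀ R, ‖s R‖ = 1) →
      (μ.real Q)⁻¹ • ∑ R ∈ B, s R • ∫ x, f R x ∂μ ∈ K := by
    intro B hB s hs
    refine smul_mem_smul_set ⟨fun x => ∑ R ∈ B, s R • f R x, ?_, ?_, ?_⟩
    · exact sum_smul_mem_selections hF (fun R hR => hAQ R (hB hR))
        (hA.subset (Finset.coe_subset.2 hB)) (fun R hR => (hf R (hB hR)).1) hs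
    · exact integrable_finsetSum _ fun R hR => (hf R (hB hR)).2.1.smul (s R)
    · refine (integral_finsetSum (f := fun R x => s R • f R x) _ fun R hR =>
        (hf R (hB hR)).2.1.smul (s R)).trans ?_
      exact Finset.sum_congr rfl fun R _ => integral_smul _ _
  have hcreal : ∀ i (r : ℝ) w, c i (r • w) = (r : 𝕜) * c i w := fun i r w => by
    rw [RCLike.real_smul_eq_coe_smul (K := 𝕜), map_smul, smul_eq_mul]
  have hsumR : ∀ i, ∑ R ∈ A, ‖c i (∫ x, f R x ∂μ)‖ ≤ μ.real Q := by
    intro i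
    -- Phases depending on `i` make the `i`-th coordinates nonnegative, so they add without
    -- cancellation.
    choose s hs hsc using fun R => RCLike.exists_norm_eq_mul_self (c i (∫ x, f R x ∂μ))
    have h := hcK i _ (hmemK A subset_rfl s hs)
    rw [hcreal, map_sum] at h
    simp only [map_smul, smul_eq_mul, ← hsc] at h
    rw [← RCLike.ofReal_sum, ← RCLike.ofReal_mul, RCLike.norm_ofReal, abs_of_nonneg (by positivity),
      inv_mul_le_one₀ hQ] at h
    exact h
  have hlow : ∀ R ∈ A, C * μ.real R ≤ ∑ i, ‖c i (∫ x, f R x ∂μ)‖ := by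
    intro R hR
    obtain ⟨-, -, hnot⟩ := hf R hR
    set I := ∫ x, f R x ∂μ
    have hIspan : I ∈ Submodule.span 𝕜 K := by
      have h := hmemK {R} (Finset.singleton_subset_iff.2 hR) (fun _ => 1) (by simp)
      simp only [Finset.sum_singleton, one_smul] at h
      have h2 := (Submodule.span 𝕜 K).smul_mem ((μ.real Q : ℝ) : 𝕜) (Submodule.subset_span h)
      rwa [← RCLike.real_smul_eq_coe_smul, smul_smul, mul_inv_cancel₀ hQ.ne', one_smul] at h2
    by_contra! hlt
    have hRpos : 0 < μ.real R := by
      have h0 : 0 ≤ ∑ i, ‖c i I‖ := Finset.sum_nonneg fun i _ => norm_nonneg _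
      exact pos_of_mul_pos_right (h0.trans_lt hlt) hC.le
    refine hnot ?_
    rw [mem_smul_set_iff_inv_smul_mem₀ hC.ne', smul_smul, ← mul_inv, ← hspan I hIspan,
      Finset.smul_sum]
    have hterm : ∀ i, (C * μ.real R)⁻¹ • (c i I • v i)
        = ((((C * μ.real R)⁻¹ : ℝ) : 𝕜) * c i I) • v i := fun i => by
      rw [RCLike.real_smul_eq_coe_smul (K := 𝕜), smul_smul]
    simp only [hterm]
    refine sum_smul_mem_of_mem_convexBodies (hull_mem_convexBodies K) hvhull ?_
    have hpos : 0 < C * μ.real R := mul_pos hC hRpos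
    simp only [norm_mul, RCLike.norm_ofReal, abs_of_pos (inv_pos.2 hpos), ← Finset.mul_sum]
    rw [inv_mul_le_one₀ hpos]
    exact hlt.le
  calc C * ∑ R ∈ A, μ.real R ≤ ∑ R ∈ A, ∑ i, ‖c i (∫ x, f R x ∂μ)‖ := by
        rw [Finset.mul_sum]; exact Finset.sum_le_sum hlow
    _ = ∑ i, ∑ R ∈ A, ‖c i (∫ x, f R x ∂μ)‖ := Finset.sum_comm
    _ ≤ ∑ _i : Fin (Module.finrank 𝕜 (Submodule.span 𝕜 K)), μ.real Q :=
        Finset.sum_le_sum fun i _ => hsumR i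
    _ = (Module.finrank 𝕜 (Submodule.span 𝕜 K)) * μ.real Q := by simp
    _ ≤ n * μ.real Q := by
        have h : Module.finrank 𝕜 (Submodule.span 𝕜 K) ≤ n := by
          simpa using Submodule.finrank_le (Submodule.span 𝕜 K)
        gcongr

/-- If the maximal elements of a finite family of subsets of `Q` are disjoint, the bad members of
the family cover at most half of `Q`. -/
theorem measure_sUnion_bad_le (hF : ∀ x, F x ∈ convexBodies 𝕜 n)
    (hFQ : MemL1 μ (restrictTo Q F)) (hQ : 0 < μ.real Q) {C : ℝ} (hC : 0 < C)
    (hnC : 2 * (n : ℝ) ≤ C) {P : Set (Set Ω)} (hP : P.Finite)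
    (hnest : ∀ R ∈ P, ∀ R' ∈ P, R ⊆ R' ∨ R' ⊆ R ∨ Disjoint R R') :
    μ (⋃₀ {R | R ∈ P ∧ R ⊆ Q ∧ ¬ average μ R F ⊆ C • hull (average μ Q F)}) ≤ μ Q / 2 := by
  classical
  set B := {R | R ∈ P ∧ R ⊆ Q ∧ ¬ average μ R F ⊆ C • hull (average μ Q F)}
  have hBfin : B.Finite := hP.subset fun R hR => hR.1
  -- Maximal bad sets cover the same union and, by nesting, are pairwise disjoint.
  have hAfin : {R | Maximal (· ∈ B) R}.Finite := hBfin.subset fun R hR => hR.1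
  set A := hAfin.toFinset
  have hAB : ∀ R ∈ A, Maximal (· ∈ B) R := fun R hR => hAfin.mem_toFinset.1 hR
  have hQtop : μ Q ≠ ∞ := fun h => by simp [measureReal_def, h] at hQ
  have hcover : ⋃₀ B ⊆ ⋃ R ∈ A, R := by
    refine sUnion_subset fun R hR => ?_
    obtain ⟨R', hle, hmax⟩ := hBfin.exists_le_maximal hR
    exact subset_iUnion₂_of_subset R' (hAfin.mem_toFinset.2 hmax) hle
  have hdisj : (A : Set (Set Ω)).PairwiseDisjoint id := by
    intro R hR R' hR' hne
    have h1 := hAB R hR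
    have h2 := hAB R' hR'
    rcases hnest R h1.1.1 R' h2.1.1 with h | h | h
    · exact (hne (h.antisymm (h1.2 h2.1 h))).elim
    · exact (hne ((h2.2 h1.1 h).antisymm h)).elim
    · exact h
  have hweak := mul_sum_measureReal_le hF hFQ hQ hC (fun R hR => (hAB R hR).1.2.1) hdisj
    fun R hR => (hAB R hR).1.2.2
  have hhalf : ∑ R ∈ A, μ.real R ≤ μ.real Q / 2 := by
    have h : C * ∑ R ∈ A, μ.real R ≤ C * (μ.real Q / 2) :=
      hweak.trans (by nlinarith)
    exact le_of_mul_le_mul_left h hC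
  calc μ (⋃₀ B) ≤ ∑ R ∈ A, μ R := (measure_mono hcover).trans (measure_biUnion_finset_le A _)
    _ = ENNReal.ofReal (∑ R ∈ A, μ.real R) := by
        rw [ENNReal.ofReal_sum_of_nonneg fun R _ => measureReal_nonneg]
        refine Finset.sum_congr rfl fun R hR => ?_
        exact (ofReal_measureReal (measure_ne_top_of_subset (hAB R hR).1.2.1 hQtop)).symm
    _ ≤ ENNReal.ofReal (μ.real Q / 2) := ENNReal.ofReal_le_ofReal hhalf
    _ = μ Q / 2 := by
        rw [ENNReal.ofReal_div_of_pos two_pos, ofReal_measureReal hQtop, ENNReal.ofReal_ofNat]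

end Averages

/-! ### From averages to maximal operators. -/

section Domination

variable {Ω : Type*} [MeasurableSpace Ω] {μ : Measure Ω} {𝕜 : Type*} [RCLike 𝕜] {n : ℕ}
  {F : Ω → Set (EuclideanSpace 𝕜 (Fin n))}

/-- If `x ∈ Q ⊆ R`, then `⟨F⟩_R` also contributes at `x`; if `x ∉ Q`, the contribution of `Q` is
only `{0}`. The inclusion thus holds at every point. -/
theorem maximalOperator_subset_smul {P S : Set (Set Ω)} {C : ℝ} (hC : C ≠ 0)
    (h : ∀ Q ∈ P, ∃ R ∈ S, Q ⊆ R ∧ average μ Q F ⊆ C • hull (average μ R F)) (x : Ω) :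
    maximalOperator μ P F x ⊆ C • maximalOperator μ S F x := by
  have hmem := smul_mem_convexBodies
    (hull_mem_convexBodies (⋃ Q ∈ S, averagingOperator μ Q F x)) hC
  refine hull_subset hmem (iUnion₂_subset fun Q hQ => ?_)
  by_cases hx : x ∈ Q
  · obtain ⟨R, hR, hQR, hsub⟩ := h Q hQ
    simp only [averagingOperator, restrictTo, hx, if_true]
    refine hsub.trans (smul_set_mono (hull_subset (hull_mem_convexBodies _) ?_))
    refine Subset.trans ?_ (subset_hull _)
    refine subset_iUnion₂_of_subset R hR ?_
    simp [averagingOperator, restrictTo, hQR hx]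
  · simp only [averagingOperator, restrictTo, hx, if_false]
    exact singleton_subset_iff.2 (zero_mem_of_mem_convexBodies hmem)

end Domination

/-! ### Cubes have positive finite volume. -/

section Cubes

variable {d : ℕ}

theorem volume_cube_lt_top (a : EuclideanSpace ℝ (Fin d)) (l : ℝ) : volume (cube a l) < ∞ := by
  have h : cube a l ⊆ WithLp.ofLp ⁻¹' (pi univ fun i => Ico (a i) (a i + l)) :=
    fun x hx i _ => hx i
  refine (measure_mono h).trans_lt ?_
  rw [(PiLp.volume_preserving_ofLp (Fin d)).measure_preimage
    (MeasurableSet.univ_pi fun _ => measurableSet_Ico).nullMeasurableSet, volume_pi_pi]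
  exact ENNReal.prod_lt_top fun i _ => measure_Ico_lt_top

theorem volume_cube_pos (a : EuclideanSpace ℝ (Fin d)) {l : ℝ} (hl : 0 < l) :
    0 < volume (cube a l) := by
  have h : WithLp.ofLp ⁻¹' (pi univ fun i => Ico (a i) (a i + l)) ⊆ cube a l :=
    fun x hx i => hx i trivial
  refine lt_of_lt_of_le ?_ (measure_mono h)
  rw [(PiLp.volume_preserving_ofLp (Fin d)).measure_preimage
    (MeasurableSet.univ_pi fun _ => measurableSet_Ico).nullMeasurableSet, volume_pi_pi]
  simp [Real.volume_Ico, pos_iff_ne_zero, hl]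

end Cubes

end ConvexBody

theorem theoremC {𝕜 : Type*} [RCLike 𝕜] {d n : ℕ} (hd : 1 ≤ d) (hn : 1 ≤ n)
    (D : Set (Set (EuclideanSpace ℝ (Fin d)))) (hD : ConvexBody.IsDyadicGrid D)
    (P : Set (Set (EuclideanSpace ℝ (Fin d)))) (hPD : P ⊆ D) (hP : P.Finite)
    (F : EuclideanSpace ℝ (Fin d) → Set (EuclideanSpace 𝕜 (Fin n)))
    (hF : ConvexBody.MemL1Loc F) :
    ∃ S : Set (Set (EuclideanSpace ℝ (Fin d))), S ⊆ P ∧ ConvexBody.IsSparse S ∧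
      ∀ᵐ x : EuclideanSpace ℝ (Fin d),
        ConvexBody.maximalOperator volume P F x ⊆
          (2 * (n : ℝ) ^ (5 / 2 : ℝ)) • ConvexBody.maximalOperator volume S F x := by
  have hn1 : (1 : ℝ) ≤ n := by exact_mod_cast hn
  have hnC : (n : ℝ) ≤ (n : ℝ) ^ (5 / 2 : ℝ) := Real.self_le_rpow_of_one_le hn1 (by norm_num)
  -- Only `2n ≤ C`, which also gives `1 ≤ C`, is needed below.
  set C := 2 * (n : ℝ) ^ (5 / 2 : ℝ)
  have hC1 : 1 ≤ C := by linarith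
  have hC : 0 < C := by linarith
  obtain ⟨l₀, hl₀, hcubes, -, hnest⟩ := hD
  have hself : ∀ Q, ConvexBody.average volume Q F ⊆
      C • ConvexBody.hull (ConvexBody.average volume Q F) := fun Q => by
    have hmem := ConvexBody.hull_mem_convexBodies (ConvexBody.average volume Q F)
    intro u hu
    rw [mem_smul_set_iff_inv_smul_mem₀ hC.ne']
    exact hmem.2.2.1.smul_mem_of_zero_mem (ConvexBody.zero_mem_of_mem_convexBodies hmem)
      (ConvexBody.subset_hull _ hu) ⟨inv_nonneg.2 hC.le, inv_le_one_of_one_le₀ hC1⟩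
  obtain ⟨S, hSP, hS, hcov⟩ := exists_stopping_family
    (fun R Q => ConvexBody.average volume R F ⊆
      C • ConvexBody.hull (ConvexBody.average volume Q F)) hself
    (fun Q A => volume A ≤ volume Q / 2) (fun Q A B hAB h => (measure_mono hAB).trans h) hP
    (fun Q hQ => by
      obtain ⟨k, a, rfl⟩ := hcubes Q (hPD hQ)
      have hl : 0 < (2 : ℝ) ^ k * l₀ := by positivity
      exact ConvexBody.measure_sUnion_bad_le hF.1.1 (hF.2 a _ hl)
        (ENNReal.toReal_pos (ConvexBody.volume_cube_pos a hl).ne'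
          (ConvexBody.volume_cube_lt_top a _).ne) hC (by linarith) hP
        fun R hR R' hR' => hnest R (hPD hR) R' (hPD hR'))
  exact ⟨S, hSP, hS, Filter.Eventually.of_forall
    (ConvexBody.maximalOperator_subset_smul hC.ne' hcov)⟩
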